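/- Let $N\ge 3$ and $2^*:=\frac{2N}{N-2}$. Let $f\in C^1[0,\infty)$ satisfy the double-power growth condition: there are constants $A_1>0$ and $2<p<2^*<q$ such that, for $m=-1,0,1$ and all $s\ge 0$, \[ |f^{(m)}(s)|\le \begin{cases} A_1\, s^{p-(m+1)} & \text{if } s\ge 1,\\ A_1\, s^{q-(m+1)} & \text{if } s\le 1,\end{cases} \] where $f^{(-1)}(s):=F(s):=\int_0^s f(t)\,dt$, $f^{(0)}:=f$ and $f^{(1)}:=f'$. Extend $f$ to an odd function on $\mathbb{R}$ by $f(s):=-f(-s)$ for $s<0$. Let \[ D^{1,2}(\mathbb{R}^N):=\{u\in L^{2^*}(\mathbb{R}^N) : \nabla u\in L^2(\mathbb{R}^N,\mathbb{R}^N)\}, \qquad \|u\|:=\Big(\int_{\mathbb{R}^N}|\nabla u|^2\Big)^{1/2}, \] where $u$ is real-valued and $\nabla u$ is its weak gradient, and write $B_R(y):=\{x\in\mathbb{R}^N : |x-y|<R\}$. If $(u_k)$ is a bounded sequence in $D^{1,2}(\mathbb{R}^N)$ and there exists $R>0$ such that \[ \lim_{k\to\infty}\Big(\sup_{y\in\mathbb{R}^N}\int_{B_R(y)}|u_k|^2\Big)=0,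 \] then $f(u_k)u_k$ is integrable on $\mathbb{R}^N$ for every $k$, and \[ \lim_{k\to\infty}\int_{\mathbb{R}^N} f(u_k)u_k=0 . \] -/

import Mathlib

open MeasureTheory Set Filter Topology
open scoped ENNReal ContDiff

noncomputable section

/-- The critical Sobolev exponent `2N/(N-2)` (meaningful for `N ≥ 3`). -/
def critExp (N : ℕ) : ℝ := 2 * (N : ℝ) / ((N : ℝ) - 2)

/-- `G` is a weak (distributional) gradient of `u` on `ℝ^N`: both are locally integrable and
`∫ u ∂ᵢφ = - ∫ Gᵢ φ` for every test function `φ ∈ C_c^∞(ℝ^N)` and every coordinate `i`. -/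
def IsWeakGradient {N : ℕ} (u : EuclideanSpace ℝ (Fin N) → ℝ)
    (G : EuclideanSpace ℝ (Fin N) → EuclideanSpace ℝ (Fin N)) : Prop :=
  LocallyIntegrable u volume ∧ LocallyIntegrable G volume ∧
    ∀ φ : EuclideanSpace ℝ (Fin N) → ℝ, ContDiff ℝ ∞ φ → HasCompactSupport φ →
      ∀ i : Fin N,
        ∫ x, u x * fderiv ℝ φ x (EuclideanSpace.single i 1) = - ∫ x, G x i * φ x

/-- `u` represents an element of `D^{1,2}(ℝ^N)`: `u ∈ L^{2^*}` and `u` has a weak gradient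
in `L²(ℝ^N, ℝ^N)`. -/
def MemD12 {N : ℕ} (u : EuclideanSpace ℝ (Fin N) → ℝ) : Prop :=
  MemLp u (ENNReal.ofReal (critExp N)) volume ∧
    ∃ G : EuclideanSpace ℝ (Fin N) → EuclideanSpace ℝ (Fin N),
      IsWeakGradient u G ∧ MemLp G 2 volume

open Classical in
/-- A square-integrable weak gradient of `u` (weak gradients are unique up to null sets);
the value is `0` if there is none. -/
def weakGrad {N : ℕ} (u : EuclideanSpace ℝ (Fin N) → ℝ) :
    EuclideanSpace ℝ (Fin N) → EuclideanSpace ℝ (Fin N) :=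
  if h : ∃ G : EuclideanSpace ℝ (Fin N) → EuclideanSpace ℝ (Fin N),
      IsWeakGradient u G ∧ MemLp G 2 volume then h.choose else 0

/-- The norm `(∫ |∇u|²)^{1/2}` of `D^{1,2}(ℝ^N)`. -/
def d12Norm {N : ℕ} (u : EuclideanSpace ℝ (Fin N) → ℝ) : ℝ :=
  Real.sqrt (∫ x, ‖weakGrad u x‖ ^ 2)

/-- The double-power growth condition on `f ∈ C¹[0,∞)`, with `F(s) = ∫₀ˢ f`. Only the values of
`f` on `[0,∞)` matter. -/
def DoublePowerGrowth (N : ℕ) (f : ℝ → ℝ) : Prop :=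
  ContDiffOn ℝ 1 f (Ici 0) ∧
    ∃ A p q : ℝ, 0 < A ∧ 2 < p ∧ p < critExp N ∧ critExp N < q ∧
      (∀ s : ℝ, 1 ≤ s →
        |∫ t in (0 : ℝ)..s, f t| ≤ A * s ^ p ∧
        |f s| ≤ A * s ^ (p - 1) ∧
        |derivWithin f (Ici 0) s| ≤ A * s ^ (p - 2)) ∧
      (∀ s : ℝ, 0 ≤ s → s ≤ 1 →
        |∫ t in (0 : ℝ)..s, f t| ≤ A * s ^ q ∧
        |f s| ≤ A * s ^ (q - 1) ∧
        |derivWithin f (Ici 0) s| ≤ A * s ^ (q - 2))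

/-- The odd extension to `ℝ` of a function given on `[0,∞)`: `s ↦ -f(-s)` for `s < 0`. -/
def oddExt (f : ℝ → ℝ) (s : ℝ) : ℝ := if 0 ≤ s then f s else - f (-s)

end

/-! The difficulty is that `u k` need not lie in `L²`, so Lions' vanishing lemma does not apply to
it directly. Compose with ψ = `cubicProfile`. It has bounded derivative and satisfies |ψ(s)|² ≤
min(s², s⁶) ≤ |s|^{2*}, because 2 < 2* ≤ 6. Hence ψ(u_k) is bounded in H¹, by Sobolev, and its local
L² masses still vanish since |ψ(s)| ≤ |s|.

Vanishing (`exists_vanishing_const`) then gives ψ(u_k) → 0 in L^r with r = 2 + 4/N. On a ball,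
interpolation and Sobolev bound ∫|ψ(u)|^r by the local H¹ energy to the first power times δ^{2/N},
where δ bounds the local L² masses. Being linear in the energy, the estimate can be integrated over
all centres.

Since p < 2* < q, for every η > 0 there is C with |f(s)s| ≤ η|s|^{2*} + C|ψ(s)|^r
(`DoublePowerGrowth.exists_abs_le_add`). The first term is uniformly small by Sobolev, the second
tends to zero.

Both integral bounds are proved for compactly supported C¹ functions. They pass to D^{1,2} by
cutoff, mollification and Fatou (`lintegral_comp_le_of_isWeakGradient`). -/

noncomputable section

/-! ### The critical exponent and the Sobolev inequality. -/

section CritExp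

variable {N : ℕ}

lemma critExp_sub_pos (hN : 3 ≤ N) : (0 : ℝ) < (N : ℝ) - 2 := by
  have : (3 : ℝ) ≤ N := by exact_mod_cast hN
  linarith

lemma two_lt_critExp (hN : 3 ≤ N) : 2 < critExp N := by
  have h := critExp_sub_pos hN
  unfold critExp
  rw [lt_div_iff₀ h]
  linarith

/-- The value 6 is attained at N = 3. It is the reason for the cubic order of `cubicProfile` at the
origin: its square is then of order s⁶. -/
lemma critExp_le_six (hN : 3 ≤ N) : critExp N ≤ 6 := by
  have h := critExp_sub_pos hN
  have : (3 : ℝ) ≤ N := by exact_mod_cast hN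
  unfold critExp
  rw [div_le_iff₀ h]
  linarith

lemma critExp_pos (hN : 3 ≤ N) : 0 < critExp N := by
  linarith [two_lt_critExp hN]

/-- The Sobolev inequality for compactly supported `C¹` functions. -/
lemma exists_sobolev_const (hN : 3 ≤ N) :
    ∃ C : ℝ≥0∞, C ≠ ⊤ ∧ ∀ w : EuclideanSpace ℝ (Fin N) → ℝ, ContDiff ℝ 1 w →
      HasCompactSupport w →
      (∫⁻ x, ‖w x‖ₑ ^ critExp N) ^ (2 / critExp N) ≤ C * ∫⁻ x, ‖fderiv ℝ w x‖ₑ ^ 2 := by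
  have h0 := critExp_pos hN
  set c := eLpNormLESNormFDerivOfEqInnerConst
    (volume : Measure (EuclideanSpace ℝ (Fin N))) 2
  refine ⟨(c : ℝ≥0∞) ^ 2, by simp, fun w hw hcw => ?_⟩
  have hfr : Module.finrank ℝ (EuclideanSpace ℝ (Fin N)) = N := by simp
  have key := eLpNorm_le_eLpNorm_fderiv_of_eq_inner (volume) hw hcw
    (p := 2) (p' := (critExp N).toNNReal) (by norm_num) (by rw [hfr]; omega) (by
      rw [hfr, Real.coe_toNNReal _ h0.le]
      have h := critExp_sub_pos hN
      have : (0 : ℝ) < N := by linarith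
      unfold critExp
      push_cast
      field_simp)
  have h2 : ((2 : NNReal) : ℝ≥0∞) = 2 := rfl
  rw [eLpNorm_eq_lintegral_rpow_enorm_toReal (by simpa using h0) (by simp),
    eLpNorm_eq_lintegral_rpow_enorm_toReal (by simp) (by simp)] at key
  simp only [ENNReal.coe_toReal, Real.coe_toNNReal _ h0.le, h2, ENNReal.toReal_ofNat,
    NNReal.coe_ofNat, ENNReal.rpow_two] at key
  have key2 := ENNReal.rpow_le_rpow key (z := 2) (by norm_num)
  rw [← ENNReal.rpow_mul, ENNReal.mul_rpow_of_nonneg _ _ (by norm_num : (0 : ℝ) ≤ 2),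
    ← ENNReal.rpow_mul] at key2
  norm_num at key2
  convert key2 using 2
  rw [div_eq_inv_mul]

end CritExp

/-! ### A truncation that sends the critical Lebesgue space into L². -/

section Profile

/-- A smooth odd function behaving like `s³` at the origin and like `s` at infinity. -/
def cubicProfile (s : ℝ) : ℝ := s ^ 3 / (1 + s ^ 2)

lemma contDiff_cubicProfile : ContDiff ℝ 1 cubicProfile := by
  unfold cubicProfile
  exact (contDiff_id.pow 3).div (contDiff_const.add (contDiff_id.pow 2)) fun x => by positivity

lemma cubicProfile_zero : cubicProfile 0 = 0 := by simp [cubicProfile]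

lemma abs_cubicProfile (s : ℝ) : |cubicProfile s| = |s| ^ 3 / (1 + |s| ^ 2) := by
  unfold cubicProfile
  rw [abs_div, abs_pow, sq_abs, abs_of_pos (by positivity : (0 : ℝ) < 1 + s ^ 2)]

lemma abs_cubicProfile_le (s : ℝ) : |cubicProfile s| ≤ |s| := by
  rw [abs_cubicProfile, div_le_iff₀ (by positivity)]
  nlinarith [abs_nonneg s]

lemma abs_cubicProfile_le_cube (s : ℝ) : |cubicProfile s| ≤ |s| ^ 3 := by
  rw [abs_cubicProfile]
  exact div_le_self (by positivity) (by nlinarith [sq_nonneg |s|])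

lemma norm_deriv_cubicProfile_le (s : ℝ) : ‖deriv cubicProfile s‖ ≤ 3 := by
  have h : HasDerivAt cubicProfile
      ((3 * s ^ 2 * (1 + s ^ 2) - s ^ 3 * (2 * s)) / (1 + s ^ 2) ^ 2) s := by
    have h1 : HasDerivAt (fun s : ℝ => s ^ 3) (3 * s ^ 2) s := by simpa using hasDerivAt_pow 3 s
    have h2 : HasDerivAt (fun s : ℝ => 1 + s ^ 2) (2 * s) s := by
      simpa using (hasDerivAt_pow 2 s).const_add 1
    exact h1.div h2 (by positivity)
  rw [h.deriv, Real.norm_eq_abs, abs_le]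
  have hp : (0 : ℝ) < (1 + s ^ 2) ^ 2 := by positivity
  constructor
  · rw [le_div_iff₀ hp]; nlinarith [sq_nonneg s, sq_nonneg (s ^ 2)]
  · rw [div_le_iff₀ hp]; nlinarith [sq_nonneg s, sq_nonneg (s ^ 2)]

/-- Keeps the profile away from zero on |s| ≥ a, so that a bounded range of values of the
nonlinearity can be absorbed into a multiple of it. -/
lemma abs_cubicProfile_mono {a s : ℝ} (ha : 0 ≤ a) (h : a ≤ |s|) :
    a ^ 3 / (1 + a ^ 2) ≤ |cubicProfile s| := by
  rw [abs_cubicProfile, div_le_div_iff₀ (by positivity) (by positivity)]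
  have h3 : a ^ 3 ≤ |s| ^ 3 := by gcongr
  have : a ^ 2 * |s| ^ 2 * a ≤ a ^ 2 * |s| ^ 2 * |s| := by gcongr
  nlinarith

/-- The cubic bound is used for |s| ≤ 1 and the linear one for |s| ≥ 1. With r = 2* this puts ψ(u)
in L² even when u is not. -/
lemma cubicProfile_sq_le {r : ℝ} (h2 : 2 ≤ r) (h6 : r ≤ 6) (s : ℝ) :
    ‖cubicProfile s‖ₑ ^ 2 ≤ ‖s‖ₑ ^ r := by
  have key : |cubicProfile s| ^ 2 ≤ |s| ^ r := by
    rcases le_total |s| 1 with h | h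
    · calc |cubicProfile s| ^ 2 ≤ (|s| ^ 3) ^ 2 := by gcongr; exact abs_cubicProfile_le_cube s
        _ = |s| ^ (6 : ℝ) := by rw [← pow_mul]; norm_cast
        _ ≤ |s| ^ r := by
          rcases eq_or_lt_of_le (abs_nonneg s) with h0 | h0
          · rw [← h0, Real.zero_rpow (by norm_num), Real.zero_rpow (by linarith)]
          · exact Real.rpow_le_rpow_of_exponent_ge h0 h h6
    · calc |cubicProfile s| ^ 2 ≤ |s| ^ 2 := by gcongr ?_ ^ 2; exact abs_cubicProfile_le s
        _ = |s| ^ (2 : ℝ) := by norm_cast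
        _ ≤ |s| ^ r := Real.rpow_le_rpow_of_exponent_le h h2
  rw [← ofReal_norm, ← ofReal_norm, Real.norm_eq_abs, Real.norm_eq_abs,
    ENNReal.ofReal_rpow_of_nonneg (abs_nonneg _) (by linarith),
    ← ENNReal.ofReal_pow (abs_nonneg _)]
  exact ENNReal.ofReal_le_ofReal key

end Profile

/-! ### Averaging over balls, in place of a covering argument. -/

section Averaging

variable {E : Type*} [NormedAddCommGroup E] [NormedSpace ℝ E] [FiniteDimensional ℝ E]
  [MeasurableSpace E] [BorelSpace E]

/-- Integrating the integrals over all balls of radius `r` gives the volume of such a ball times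
the full integral. -/
lemma lintegral_setLIntegral_ball (μ : Measure E) [μ.IsAddHaarMeasure] {F : E → ℝ≥0∞}
    (hF : Measurable F) (r : ℝ) :
    ∫⁻ y, ∫⁻ x in Metric.ball y r, F x ∂μ ∂μ = μ (Metric.ball 0 r) * ∫⁻ x, F x ∂μ := by
  have h1 : ∀ y, ∫⁻ x in Metric.ball y r, F x ∂μ
      = ∫⁻ x, {p : E × E | dist p.2 p.1 < r}.indicator (fun p => F p.2) (y, x) ∂μ := by
    intro y
    rw [← lintegral_indicator Metric.isOpen_ball.measurableSet]
    rfl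
  have hS : MeasurableSet {p : E × E | dist p.2 p.1 < r} :=
    (isOpen_lt (by fun_prop) continuous_const).measurableSet
  simp_rw [h1]
  rw [lintegral_lintegral_swap]
  · rw [← lintegral_const_mul _ hF]
    refine lintegral_congr fun x => ?_
    have : ∀ y, {p : E × E | dist p.2 p.1 < r}.indicator (fun p => F p.2) (y, x)
        = (Metric.ball x r).indicator (fun _ => F x) y := by
      intro y
      by_cases h : dist x y < r
      · rw [indicator_of_mem (show (y, x) ∈ {p : E × E | dist p.2 p.1 < r} from h),
          indicator_of_mem (by rwa [Metric.mem_ball, dist_comm])]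
      · rw [indicator_of_notMem (show (y, x) ∉ {p : E × E | dist p.2 p.1 < r} from h),
          indicator_of_notMem (by rwa [Metric.mem_ball, dist_comm])]
    simp_rw [this]
    rw [lintegral_indicator_const Metric.isOpen_ball.measurableSet, mul_comm,
      ← Measure.addHaar_ball_center μ x r]
  · exact ((hF.comp measurable_snd).indicator hS).aemeasurable

end Averaging

/-! ### Lions' vanishing lemma for the truncated function. -/

section Vanishing

variable {N : ℕ}

/-- Interpolation between `L²` and the critical Lebesgue space. -/
lemma lintegral_interpolation (hN : 3 ≤ N) {α : Type*} [MeasurableSpace α] {μ : Measure α}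
    {g : α → ℝ≥0∞} (hg : AEMeasurable g μ) :
    ∫⁻ x, g x ^ (2 + 4 / (N : ℝ)) ∂μ
      ≤ (∫⁻ x, g x ^ critExp N ∂μ) ^ (2 / critExp N) * (∫⁻ x, g x ^ 2 ∂μ) ^ (2 / (N : ℝ)) := by
  have h := critExp_sub_pos hN
  have hN0 : (0 : ℝ) < N := by linarith
  -- Hölder for g² · g^{4/N}. The exponent 2 + 4/N is the one for which the critical norm enters
  -- exactly squared, hence is controlled by the Dirichlet integral to the first power.
  have hconj : (critExp N / 2).HolderConjugate ((N : ℝ) / 2) := by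
    rw [Real.holderConjugate_iff]
    refine ⟨by linarith [two_lt_critExp hN], ?_⟩
    unfold critExp
    field_simp
    ring
  have key := ENNReal.lintegral_mul_le_Lp_mul_Lq μ hconj
    (hg.pow_const (2 : ℝ)) (hg.pow_const (4 / (N : ℝ)))
  have e1 : ∀ x, ((fun x => g x ^ (2 : ℝ)) * fun x => g x ^ (4 / (N : ℝ))) x
      = g x ^ (2 + 4 / (N : ℝ)) := fun x => by
    rw [Pi.mul_apply, ENNReal.rpow_add_of_nonneg _ _ (by norm_num) (by positivity)]
  simp only [e1, ← ENNReal.rpow_mul] at key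
  have e2 : 2 * (critExp N / 2) = critExp N := by ring
  have e3 : 4 / (N : ℝ) * (N / 2) = 2 := by field_simp; norm_num
  rw [e2, e3] at key
  simpa only [one_div_div, ENNReal.rpow_two] using key

/-- A vanishing lemma for compactly supported `C¹` functions. -/
lemma exists_vanishing_const (hN : 3 ≤ N) {R : ℝ} (hR : 0 < R) {K : ℝ≥0∞} (hK : K ≠ ⊤) :
    ∃ C : ℝ≥0∞, C ≠ ⊤ ∧ ∀ w : EuclideanSpace ℝ (Fin N) → ℝ, ContDiff ℝ 1 w →
      HasCompactSupport w → ∫⁻ x, ‖fderiv ℝ w x‖ₑ ^ 2 ≤ K → ∀ δ : ℝ≥0∞, δ ≠ ⊤ →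
      (∀ y, ∫⁻ x in Metric.ball y R, ‖w x‖ₑ ^ 2 ≤ δ) →
      ∫⁻ x, ‖cubicProfile (w x)‖ₑ ^ (2 + 4 / (N : ℝ)) ≤ C * δ ^ (2 / (N : ℝ)) := by
  have h0 := critExp_pos hN
  have hN2 := critExp_sub_pos hN
  have hN0 : (0 : ℝ) < N := by linarith
  obtain ⟨S, hS, hsob⟩ := exists_sobolev_const hN
  -- Equal to 1 on the ball of radius R/4, with support strictly inside the ball of radius R.
  let φ : ContDiffBump (0 : EuclideanSpace ℝ (Fin N)) := ⟨R / 4, R / 2, by linarith, by linarith⟩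
  have hφc : ContDiff ℝ 1 φ := φ.contDiff
  obtain ⟨M, hM⟩ := (hφc.continuous_fderiv one_ne_zero).bounded_above_of_compact_support
    (φ.hasCompactSupport.fderiv ℝ)
  set V : ℝ → ℝ≥0∞ := fun r => volume (Metric.ball (0 : EuclideanSpace ℝ (Fin N)) r) with hV
  have hVpos : V (R / 4) ≠ 0 := (Metric.measure_ball_pos _ _ (by linarith)).ne'
  have hVtop : ∀ r, V r ≠ ⊤ := fun r => measure_ball_lt_top.ne
  -- Bounds ∫ g² for the function g below, which dominates the gradients of all localisations of
  -- ψ(w). The 2 comes from (a + b)² ≤ 2(a² + b²), the 9 from |ψ'| ≤ 3, M from the gradient of the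
  -- bump, and the last power from ψ² ≤ |s|^{2*} with Sobolev.
  set B : ℝ≥0∞ := 2 * (9 * K + ENNReal.ofReal M ^ 2 * (S * K) ^ (critExp N / 2)) with hB
  have hBtop : B ≠ ⊤ := by
    have : (S * K) ^ (critExp N / 2) ≠ ⊤ :=
      ENNReal.rpow_ne_top_of_nonneg (by linarith) (ENNReal.mul_ne_top hS hK)
    finiteness
  refine ⟨(V (R / 4))⁻¹ * (S * (V R * B)), ?_, fun w hw hcw hwK δ hδt hδ => ?_⟩
  · have := hVtop R
    have := ENNReal.inv_ne_top.2 hVpos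
    finiteness
  set v : EuclideanSpace ℝ (Fin N) → ℝ := fun x => cubicProfile (w x) with hv
  have hvc : ContDiff ℝ 1 v := contDiff_cubicProfile.comp hw
  set g : EuclideanSpace ℝ (Fin N) → ℝ≥0∞ :=
    fun x => 3 * ‖fderiv ℝ w x‖ₑ + ENNReal.ofReal M * ‖v x‖ₑ with hg
  have hgm : Measurable g := by
    have h1 : Measurable fun x => ‖fderiv ℝ w x‖ₑ :=
      (hw.continuous_fderiv one_ne_zero).enorm.measurable
    have h2 : Measurable fun x => ‖v x‖ₑ := hvc.continuous.enorm.measurable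
    fun_prop
  have hdv : ∀ x, ‖fderiv ℝ v x‖ₑ ≤ 3 * ‖fderiv ℝ w x‖ₑ := by
    intro x
    have hd : HasFDerivAt v (deriv cubicProfile (w x) • fderiv ℝ w x) x :=
      ((contDiff_cubicProfile.differentiable one_ne_zero) (w x)).hasDerivAt.comp_hasFDerivAt x
        ((hw.differentiable one_ne_zero) x).hasFDerivAt
    rw [hd.fderiv, enorm_smul]
    gcongr
    rw [← ofReal_norm]
    simpa using ENNReal.ofReal_le_ofReal (norm_deriv_cubicProfile_le (w x))
  have hgB : ∫⁻ x, g x ^ 2 ≤ B := by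
    have hpt : ∀ x, g x ^ 2
        ≤ 2 * (9 * ‖fderiv ℝ w x‖ₑ ^ 2 + ENNReal.ofReal M ^ 2 * ‖w x‖ₑ ^ critExp N) := by
      intro x
      have := ENNReal.rpow_add_le_mul_rpow_add_rpow (3 * ‖fderiv ℝ w x‖ₑ)
        (ENNReal.ofReal M * ‖v x‖ₑ) (p := 2) (by norm_num)
      norm_num at this
      refine this.trans ?_
      rw [mul_pow, mul_pow]
      norm_num
      gcongr
      exact cubicProfile_sq_le (two_lt_critExp hN).le (critExp_le_six hN) (w x)
    have hm1 : Measurable fun x => ‖fderiv ℝ w x‖ₑ ^ 2 :=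
      (hw.continuous_fderiv one_ne_zero).enorm.measurable.pow_const 2
    have hm2 : Measurable fun x => ‖w x‖ₑ ^ critExp N :=
      hw.continuous.enorm.measurable.pow_const _
    refine (lintegral_mono hpt).trans ?_
    rw [lintegral_const_mul _ (by fun_prop), lintegral_add_left (by fun_prop),
      lintegral_const_mul _ hm1, lintegral_const_mul _ hm2, hB]
    gcongr
    have := ENNReal.rpow_le_rpow (hsob w hw hcw) (z := critExp N / 2) (by linarith)
    rw [← ENNReal.rpow_mul, show 2 / critExp N * (critExp N / 2) = 1 by field_simp,
      ENNReal.rpow_one] at this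
    refine this.trans ?_
    gcongr
  -- Sobolev and interpolation for the localised function φ(· - y)ψ(w); its L² mass is at most δ
  -- because |ψ(s)| ≤ |s|.
  have hloc : ∀ y, ∫⁻ x in Metric.ball y (R / 4), ‖v x‖ₑ ^ (2 + 4 / (N : ℝ))
      ≤ S * (∫⁻ x in Metric.ball y R, g x ^ 2) * δ ^ (2 / (N : ℝ)) := by
    intro y
    have hφy : ContDiff ℝ 1 fun x => φ (x - y) := hφc.comp (contDiff_id.sub contDiff_const)
    set z : EuclideanSpace ℝ (Fin N) → ℝ := fun x => φ (x - y) * v x with hz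
    have hzc : ContDiff ℝ 1 z := hφy.mul hvc
    have hzs : HasCompactSupport z := by
      have : HasCompactSupport v := hcw.comp_left cubicProfile_zero
      exact this.mul_left
    have hout : ∀ x, x ∉ Metric.ball y R → x - y ∉ tsupport φ := by
      intro x hx hx2
      rw [φ.tsupport_eq, mem_closedBall_zero_iff] at hx2
      rw [Metric.mem_ball, dist_eq_norm] at hx
      change ‖x - y‖ ≤ R / 2 at hx2
      linarith
    have hdz : ∀ x, ‖fderiv ℝ z x‖ₑ ^ 2 ≤ (Metric.ball y R).indicator (fun x => g x ^ 2) x := by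
      intro x
      have h1 : HasFDerivAt (fun x => φ (x - y)) (fderiv ℝ φ (x - y)) x := by
        have := ((hφc.differentiable one_ne_zero) (x - y)).hasFDerivAt.comp x
          ((hasFDerivAt_id x).sub_const y)
        rwa [ContinuousLinearMap.comp_id] at this
      have h2 : fderiv ℝ z x = φ (x - y) • fderiv ℝ v x + v x • fderiv ℝ φ (x - y) :=
        (h1.mul ((hvc.differentiable one_ne_zero) x).hasFDerivAt).fderiv
      by_cases hx : x ∈ Metric.ball y R
      · rw [indicator_of_mem hx, h2]
        gcongr
        have hadd := enorm_add_le (φ (x - y) • fderiv ℝ v x) (v x • fderiv ℝ φ (x - y))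
        refine hadd.trans ?_
        rw [enorm_smul, enorm_smul, hg]
        refine add_le_add ?_ ?_
        · have : ‖φ (x - y)‖ₑ ≤ 1 := by
            rw [← ofReal_norm, Real.norm_eq_abs, abs_of_nonneg φ.nonneg]
            exact ENNReal.ofReal_le_one.2 φ.le_one
          calc _ ≤ 1 * (3 * ‖fderiv ℝ w x‖ₑ) := mul_le_mul' this (hdv x)
            _ = _ := one_mul _
        · rw [mul_comm]
          gcongr
          rw [← ofReal_norm]
          exact ENNReal.ofReal_le_ofReal (hM _)
      · have h3 := hout x hx
        have h4 : φ (x - y) = 0 := image_eq_zero_of_notMem_tsupport h3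
        have h5 : fderiv ℝ φ (x - y) = 0 := by
          by_contra h
          exact h3 (support_fderiv_subset ℝ h)
        have h6 : fderiv ℝ z x = 0 := by rw [h2, h4, h5, zero_smul, smul_zero, add_zero]
        have h7 : ‖fderiv ℝ z x‖ₑ = 0 := by
          rw [← ofReal_norm, h6, norm_zero, ENNReal.ofReal_zero]
        rw [h7]
        simp
    calc ∫⁻ x in Metric.ball y (R / 4), ‖v x‖ₑ ^ (2 + 4 / (N : ℝ))
        = ∫⁻ x in Metric.ball y (R / 4), ‖z x‖ₑ ^ (2 + 4 / (N : ℝ)) := by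
          refine setLIntegral_congr_fun Metric.isOpen_ball.measurableSet fun x hx => ?_
          have : φ (x - y) = 1 := φ.one_of_mem_closedBall (by
            rw [mem_closedBall_zero_iff, ← dist_eq_norm]
            exact (Metric.mem_ball.1 hx).le)
          simp only [hz, this, one_mul]
      _ ≤ ∫⁻ x, ‖z x‖ₑ ^ (2 + 4 / (N : ℝ)) := setLIntegral_le_lintegral _ _
      _ ≤ (∫⁻ x, ‖z x‖ₑ ^ critExp N) ^ (2 / critExp N) * (∫⁻ x, ‖z x‖ₑ ^ 2) ^ (2 / (N : ℝ)) :=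
          lintegral_interpolation hN hzc.continuous.enorm.measurable.aemeasurable
      _ ≤ S * (∫⁻ x in Metric.ball y R, g x ^ 2) * δ ^ (2 / (N : ℝ)) := by
          gcongr
          · refine (hsob z hzc hzs).trans ?_
            refine mul_le_mul_right ?_ S
            rw [← lintegral_indicator Metric.isOpen_ball.measurableSet]
            exact lintegral_mono hdz
          · refine le_trans ?_ (hδ y)
            rw [← lintegral_indicator Metric.isOpen_ball.measurableSet]
            refine lintegral_mono fun x => ?_
            by_cases hx : x ∈ Metric.ball y R
            · rw [indicator_of_mem hx]
              gcongr 1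
              rw [enorm_le_iff_norm_le, hz, norm_mul, Real.norm_eq_abs, abs_of_nonneg φ.nonneg]
              calc _ ≤ 1 * ‖v x‖ := by gcongr; exact φ.le_one
                _ ≤ ‖w x‖ := by rw [one_mul]; exact abs_cubicProfile_le (w x)
            · have h4 : φ (x - y) = 0 := image_eq_zero_of_notMem_tsupport (hout x hx)
              simp [hz, h4]
  have hvm : Measurable fun x => ‖v x‖ₑ ^ (2 + 4 / (N : ℝ)) :=
    hvc.continuous.enorm.measurable.pow_const _
  have hint : V (R / 4) * ∫⁻ x, ‖v x‖ₑ ^ (2 + 4 / (N : ℝ))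
      ≤ S * (V R * B) * δ ^ (2 / (N : ℝ)) := by
    rw [hV, ← lintegral_setLIntegral_ball volume hvm]
    -- Linearity of the local bound in ∫ g² makes integration over y possible: Fubini turns both
    -- sides into full integrals times ball volumes.
    calc _ ≤ ∫⁻ y, S * δ ^ (2 / (N : ℝ)) * ∫⁻ x in Metric.ball y R, g x ^ 2 :=
          lintegral_mono fun y => (hloc y).trans_eq (by ring)
      _ ≤ S * δ ^ (2 / (N : ℝ)) * (V R * B) := by
          have hT : S * δ ^ (2 / (N : ℝ)) ≠ ⊤ :=
            ENNReal.mul_ne_top hS (ENNReal.rpow_ne_top_of_nonneg (by positivity) hδt)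
          rw [lintegral_const_mul' _ _ hT, lintegral_setLIntegral_ball volume (hgm.pow_const 2)]
          gcongr
      _ = _ := by ring
  calc ∫⁻ x, ‖v x‖ₑ ^ (2 + 4 / (N : ℝ))
      = (V (R / 4))⁻¹ * (V (R / 4) * ∫⁻ x, ‖v x‖ₑ ^ (2 + 4 / (N : ℝ))) := by
        rw [← mul_assoc, ENNReal.inv_mul_cancel hVpos (hVtop _), one_mul]
    _ ≤ (V (R / 4))⁻¹ * (S * (V R * B) * δ ^ (2 / (N : ℝ))) := by gcongr
    _ = _ := by ring

end Vanishing

/-! ### Fatou and Jensen, the tools for passing to limits. -/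

section Fatou

variable {α : Type*} [MeasurableSpace α] {μ : Measure α}

/-- Fatou's lemma in the form of lower semicontinuity of an integral functional with a continuous
integrand under almost everywhere convergence. -/
lemma lintegral_comp_le_of_ae_tendsto {H : ℝ → ℝ≥0∞} (hH : Continuous H) {w : ℕ → α → ℝ}
    (hw : ∀ n, Measurable (w n)) {u : α → ℝ}
    (hlim : ∀ᵐ x ∂μ, Tendsto (fun n => w n x) atTop (𝓝 (u x))) {c : ℝ≥0∞}
    (hc : ∀ᶠ n in atTop, ∫⁻ x, H (w n x) ∂μ ≤ c) : ∫⁻ x, H (u x) ∂μ ≤ c := by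
  calc ∫⁻ x, H (u x) ∂μ = ∫⁻ x, liminf (fun n => H (w n x)) atTop ∂μ := by
        refine lintegral_congr_ae ?_
        filter_upwards [hlim] with x hx
        exact (((hH.tendsto _).comp hx).liminf_eq).symm
    _ ≤ liminf (fun n => ∫⁻ x, H (w n x) ∂μ) atTop :=
        lintegral_liminf_le fun n => hH.measurable.comp (hw n)
    _ ≤ c := liminf_le_of_frequently_le' hc.frequently

/-- Jensen's inequality for powers. -/
lemma rpow_lintegral_le_lintegral_rpow [IsProbabilityMeasure μ] {g : α → ℝ≥0∞}
    (hg : AEMeasurable g μ) {p : ℝ} (hp : 1 ≤ p) :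
    (∫⁻ x, g x ∂μ) ^ p ≤ ∫⁻ x, g x ^ p ∂μ := by
  have h := eLpNorm'_le_eLpNorm'_of_exponent_le one_pos hp μ hg.aestronglyMeasurable
  simp only [eLpNorm', enorm_eq_self, ENNReal.rpow_one, div_one] at h
  calc (∫⁻ x, g x ∂μ) ^ p ≤ ((∫⁻ x, g x ^ p ∂μ) ^ (1 / p)) ^ p :=
        ENNReal.rpow_le_rpow h (by linarith)
    _ = _ := by
        rw [← ENNReal.rpow_mul, one_div_mul_cancel (by linarith), ENNReal.rpow_one]

end Fatou

/-! ### Removing compact support by cutoff. -/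

section Cutoff

variable {N : ℕ}

lemma tendsto_setLIntegral_compl_ball {E : Type*} [NormedAddCommGroup E] [MeasurableSpace E]
    [BorelSpace E] {μ : Measure E} {F : E → ℝ≥0∞} (hF : Measurable F) (hfin : ∫⁻ x, F x ∂μ ≠ ⊤) :
    Tendsto (fun n : ℕ => ∫⁻ x in (Metric.ball 0 ((n : ℝ) + 1))ᶜ, F x ∂μ) atTop (𝓝 0) := by
  have hS : ∀ n : ℕ, MeasurableSet (Metric.ball (0 : E) ((n : ℝ) + 1))ᶜ :=
    fun n => Metric.isOpen_ball.measurableSet.compl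
  have hI : ∀ n : ℕ, ∫⁻ x in (Metric.ball 0 ((n : ℝ) + 1))ᶜ, F x ∂μ
      = ∫⁻ x, (Metric.ball 0 ((n : ℝ) + 1))ᶜ.indicator F x ∂μ :=
    fun n => (lintegral_indicator (hS n) F).symm
  simp_rw [hI]
  have := tendsto_lintegral_of_dominated_convergence (μ := μ)
    (F := fun (n : ℕ) => (Metric.ball (0 : E) ((n : ℝ) + 1))ᶜ.indicator F) (f := fun _ => 0) F
    (fun n => hF.indicator (hS n)) (fun n => ae_of_all _ fun x => indicator_le_self _ _ x) hfin
    (ae_of_all _ fun x => ?_)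
  · simpa using this
  · refine tendsto_const_nhds.congr' ?_
    filter_upwards [tendsto_natCast_atTop_atTop.eventually_ge_atTop ‖x‖] with n hn
    rw [indicator_of_notMem]
    simp only [mem_compl_iff, mem_ball_zero_iff, not_not]
    linarith

/-- The L^N norm is invariant under F ↦ tF(t·), the scaling of the gradient of a dilated cutoff.
These gradients therefore stay bounded in L^N as t → 0. -/
lemma lintegral_comp_smul_pow {F : EuclideanSpace ℝ (Fin N) → ℝ≥0∞} (hF : Measurable F) {t : ℝ}
    (ht : 0 < t) :
    ∫⁻ x, (ENNReal.ofReal t * F (t • x)) ^ (N : ℝ) = ∫⁻ x, F x ^ (N : ℝ) := by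
  have hm : Measurable fun x => (ENNReal.ofReal t * F x) ^ (N : ℝ) := by fun_prop
  have h := lintegral_map (μ := volume) hm (measurable_const_smul (α := EuclideanSpace ℝ (Fin N)) t)
  rw [Measure.map_addHaar_smul _ ht.ne', lintegral_smul_measure] at h
  rw [← h]
  simp_rw [ENNReal.mul_rpow_of_nonneg _ _ (Nat.cast_nonneg N)]
  rw [lintegral_const_mul _ (by fun_prop), smul_eq_mul, ← mul_assoc, finrank_euclideanSpace,
    Fintype.card_fin, ENNReal.rpow_natCast, ← ENNReal.ofReal_pow ht.le,
    ← ENNReal.ofReal_mul (by positivity), abs_of_pos (by positivity),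
    inv_mul_cancel₀ (by positivity), ENNReal.ofReal_one, one_mul]

/-- Hölder's inequality with exponents `N / 2` and `2^* / 2`. -/
lemma lintegral_mul_sq_le (hN : 3 ≤ N) {α : Type*} [MeasurableSpace α] {μ : Measure α}
    {f g : α → ℝ≥0∞} (hf : AEMeasurable f μ) (hg : AEMeasurable g μ) :
    ∫⁻ x, (f x * g x) ^ 2 ∂μ ≤ (∫⁻ x, f x ^ (N : ℝ) ∂μ) ^ (2 / (N : ℝ)) *
      (∫⁻ x, g x ^ critExp N ∂μ) ^ (2 / critExp N) := by
  have h := critExp_sub_pos hN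
  have hN0 : (0 : ℝ) < N := by linarith
  have hN3 : (3 : ℝ) ≤ N := by exact_mod_cast hN
  have hconj : ((N : ℝ) / 2).HolderConjugate (critExp N / 2) := by
    rw [Real.holderConjugate_iff]
    refine ⟨by linarith, ?_⟩
    unfold critExp
    field_simp
    ring
  have key := ENNReal.lintegral_mul_le_Lp_mul_Lq μ hconj
    (hf.pow_const (2 : ℝ)) (hg.pow_const (2 : ℝ))
  simp only [Pi.mul_apply, ← ENNReal.rpow_mul] at key
  have e2 : 2 * (critExp N / 2) = critExp N := by ring
  have e3 : 2 * ((N : ℝ) / 2) = N := by ring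
  rw [e2, e3] at key
  simpa only [one_div_div, ENNReal.rpow_two, mul_pow] using key

/-- A bound valid for compactly supported `C¹` functions extends to `C¹` functions in the critical
Lebesgue space. -/
lemma lintegral_comp_le_of_contDiff (hN : 3 ≤ N) {H : ℝ → ℝ≥0∞} (hH : Continuous H) {R : ℝ}
    {K δ c : ℝ≥0∞}
    (h : ∀ w : EuclideanSpace ℝ (Fin N) → ℝ, ContDiff ℝ 1 w → HasCompactSupport w →
      ∫⁻ x, ‖fderiv ℝ w x‖ₑ ^ 2 ≤ K → (∀ y, ∫⁻ x in Metric.ball y R, ‖w x‖ₑ ^ 2 ≤ δ) →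
      ∫⁻ x, H (w x) ≤ c)
    {w : EuclideanSpace ℝ (Fin N) → ℝ} (hw : ContDiff ℝ 1 w)
    (hcrit : ∫⁻ x, ‖w x‖ₑ ^ critExp N ≠ ⊤) (hK : ∫⁻ x, ‖fderiv ℝ w x‖ₑ ^ 2 < K)
    (hδ : ∀ y, ∫⁻ x in Metric.ball y R, ‖w x‖ₑ ^ 2 ≤ δ) :
    ∫⁻ x, H (w x) ≤ c := by
  have h0 := critExp_pos hN
  have hN2 := critExp_sub_pos hN
  let χ : ContDiffBump (0 : EuclideanSpace ℝ (Fin N)) := ⟨1, 2, by norm_num, by norm_num⟩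
  have hχc : ContDiff ℝ 1 χ := χ.contDiff
  have hχd := hχc.continuous_fderiv one_ne_zero
  set t : ℕ → ℝ := fun n => ((n : ℝ) + 1)⁻¹ with ht
  have htpos : ∀ n, 0 < t n := fun n => by positivity
  have ht0 : Tendsto t atTop (𝓝 0) := by
    simpa only [ht, one_div] using tendsto_one_div_add_atTop_nhds_zero_nat (𝕜 := ℝ)
  have hχt : ∀ n, ContDiff ℝ 1 fun x => χ (t n • x) :=
    fun n => hχc.comp (contDiff_const_smul (t n))
  set v : ℕ → EuclideanSpace ℝ (Fin N) → ℝ := fun n x => χ (t n • x) * w x with hv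
  have hvc : ∀ n, ContDiff ℝ 1 (v n) := fun n => (hχt n).mul hw
  have hχ1 : ∀ n x, ‖v n x‖ₑ ≤ ‖w x‖ₑ := by
    intro n x
    rw [enorm_le_iff_norm_le]
    simp only [hv, norm_mul, Real.norm_eq_abs, abs_of_nonneg χ.nonneg]
    exact mul_le_of_le_one_left (abs_nonneg _) χ.le_one
  refine lintegral_comp_le_of_ae_tendsto hH (w := v) (fun n => (hvc n).continuous.measurable)
    (ae_of_all _ fun x => ?_) ?_
  · have h1 : Tendsto (fun n => t n • x) atTop (𝓝 0) := by
      simpa using ht0.smul_const x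
    have h2 := (hχc.continuous.tendsto 0).comp h1
    have h3 : χ (0 : EuclideanSpace ℝ (Fin N)) = 1 :=
      χ.one_of_mem_closedBall (Metric.mem_closedBall_self χ.rIn_pos.le)
    rw [h3] at h2
    simpa using h2.mul_const (w x)
  set b : ℕ → EuclideanSpace ℝ (Fin N) → ℝ≥0∞ :=
    fun n x => ENNReal.ofReal (t n) * ‖fderiv ℝ χ (t n • x)‖ₑ with hb
  set T : ℕ → Set (EuclideanSpace ℝ (Fin N)) := fun n => (Metric.ball 0 ((n : ℝ) + 1))ᶜ with hT
  have hTm : ∀ n, MeasurableSet (T n) := fun n => Metric.isOpen_ball.measurableSet.compl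
  have hbm : ∀ n, Measurable (b n) := fun n =>
    ((hχd.comp (continuous_const_smul (t n))).enorm.measurable).const_mul _
  have hwm : Measurable fun x => ‖w x‖ₑ := hw.continuous.enorm.measurable
  have hwd : Measurable fun x => ‖fderiv ℝ w x‖ₑ :=
    (hw.continuous_fderiv one_ne_zero).enorm.measurable
  -- The error |w||∇χ(t·)|t made by the cutoff. It lives outside the ball of radius n + 1, since χ
  -- is 1 on the unit ball.
  set a : ℕ → EuclideanSpace ℝ (Fin N) → ℝ≥0∞ :=
    fun n x => b n x * (T n).indicator (fun x => ‖w x‖ₑ) x with ha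
  have ham : ∀ n, Measurable (a n) := fun n => (hbm n).mul (hwm.indicator (hTm n))
  have hdv : ∀ n x, ‖fderiv ℝ (v n) x‖ₑ ≤ ‖fderiv ℝ w x‖ₑ + a n x := by
    intro n x
    have h1 : HasFDerivAt (fun x => χ (t n • x)) (t n • fderiv ℝ χ (t n • x)) x := by
      have := ((hχc.differentiable one_ne_zero) (t n • x)).hasFDerivAt.comp x
        ((hasFDerivAt_id x).const_smul (t n))
      rwa [ContinuousLinearMap.comp_smul, ContinuousLinearMap.comp_id] at this
    have h2 : fderiv ℝ (v n) x = χ (t n • x) • fderiv ℝ w x + w x • (t n • fderiv ℝ χ (t n • x)) :=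
      (h1.mul ((hw.differentiable one_ne_zero) x).hasFDerivAt).fderiv
    have hadd := enorm_add_le (χ (t n • x) • fderiv ℝ w x) (w x • (t n • fderiv ℝ χ (t n • x)))
    rw [h2]
    refine hadd.trans (add_le_add ?_ ?_)
    · rw [enorm_smul]
      have : ‖χ (t n • x)‖ₑ ≤ 1 := by
        rw [← ofReal_norm, Real.norm_eq_abs, abs_of_nonneg χ.nonneg]
        exact ENNReal.ofReal_le_one.2 χ.le_one
      exact mul_le_of_le_one_left zero_le this
    · by_cases hx : x ∈ T n
      · rw [enorm_smul, enorm_smul, ha]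
        simp only [indicator_of_mem hx, hb]
        rw [mul_comm ‖w x‖ₑ, Real.enorm_of_nonneg (htpos n).le]
      · have hlt : ‖t n • x‖ < 1 := by
          simp only [hT, mem_compl_iff, mem_ball_zero_iff, not_not] at hx
          rw [norm_smul, Real.norm_of_nonneg (htpos n).le, ht, inv_mul_lt_iff₀ (by positivity)]
          linarith
        have h3 : fderiv ℝ χ (t n • x) = 0 := by
          have : χ =ᶠ[𝓝 (t n • x)] fun _ => (1 : ℝ) := by
            filter_upwards [Metric.isOpen_ball.mem_nhds (mem_ball_zero_iff.2 hlt)] with y hy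
            exact χ.one_of_mem_closedBall (Metric.ball_subset_closedBall hy)
          rw [this.fderiv_eq]
          simp
        have h4 : ‖w x • (t n • fderiv ℝ χ (t n • x))‖ₑ = 0 := by
          rw [← ofReal_norm, h3, smul_zero, smul_zero, norm_zero, ENNReal.ofReal_zero]
        rw [h4]
        exact zero_le
  -- As w need not be in L², Hölder pairs the scale-invariant L^N norm of the cutoff gradient with
  -- the critical integral of w over the exterior, which tends to zero.
  have hlim : Tendsto (fun n => ∫⁻ x, a n x ^ 2) atTop (𝓝 0) := by
    set Cχ : ℝ≥0∞ := (∫⁻ x, ‖fderiv ℝ χ x‖ₑ ^ (N : ℝ)) ^ (2 / (N : ℝ)) with hCχ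
    have hCfin : Cχ ≠ ⊤ := by
      refine ENNReal.rpow_ne_top_of_nonneg (by positivity) ?_
      have hL : MemLp (fderiv ℝ χ) (N : ℝ≥0∞) volume :=
        hχd.memLp_of_hasCompactSupport (χ.hasCompactSupport.fderiv ℝ)
      have := lintegral_rpow_enorm_lt_top_of_eLpNorm_lt_top (p := (N : ℝ≥0∞))
        (by exact_mod_cast (by omega : N ≠ 0)) (by simp) hL.2
      simpa using this.ne
    have htail := tendsto_setLIntegral_compl_ball (μ := volume) (hwm.pow_const (critExp N)) hcrit
    have hlim2 := (ENNReal.Tendsto.const_mul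
      (htail.ennrpow_const (2 / critExp N)) (Or.inr hCfin) : Tendsto _ _ (𝓝 (Cχ * _)))
    rw [ENNReal.zero_rpow_of_pos (by positivity), mul_zero] at hlim2
    refine tendsto_of_tendsto_of_tendsto_of_le_of_le tendsto_const_nhds hlim2
      (fun _ => zero_le) fun n => ?_
    refine (lintegral_mul_sq_le hN (hbm n).aemeasurable
      (hwm.indicator (hTm n)).aemeasurable).trans_eq ?_
    rw [hCχ, ← lintegral_comp_smul_pow hχd.enorm.measurable (htpos n),
      ← lintegral_indicator (hTm n)]
    congr 3
    ext x
    by_cases hx : x ∈ T n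
    · simp [indicator_of_mem hx]
    · simp [indicator_of_notMem hx, ENNReal.zero_rpow_of_pos h0]
  -- Minkowski in L². The strict inequality in `hK` leaves room for the error term.
  have hev : ∀ᶠ n in atTop, ∫⁻ x, ‖fderiv ℝ (v n) x‖ₑ ^ 2 ≤ K := by
    have h1 : Tendsto (fun n => ((∫⁻ x, ‖fderiv ℝ w x‖ₑ ^ 2) ^ (1 / (2 : ℝ))
        + (∫⁻ x, a n x ^ 2) ^ (1 / (2 : ℝ))) ^ (2 : ℝ)) atTop
        (𝓝 (∫⁻ x, ‖fderiv ℝ w x‖ₑ ^ 2)) := by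
      have := ((hlim.ennrpow_const (1 / (2 : ℝ))).const_add
        ((∫⁻ x, ‖fderiv ℝ w x‖ₑ ^ 2) ^ (1 / (2 : ℝ)))).ennrpow_const 2
      rw [ENNReal.zero_rpow_of_pos (by positivity), add_zero, ← ENNReal.rpow_mul] at this
      simpa using this
    filter_upwards [h1.eventually_lt_const hK] with n hn
    refine le_trans ?_ hn.le
    have h2 := ENNReal.lintegral_Lp_add_le (p := 2) hwd.aemeasurable (ham n).aemeasurable
      (μ := volume) (by norm_num)
    simp only [ENNReal.rpow_two] at h2
    have h3 := ENNReal.rpow_le_rpow h2 (z := 2) (by norm_num)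
    rw [← ENNReal.rpow_mul, one_div_mul_cancel (by norm_num), ENNReal.rpow_one] at h3
    refine le_trans (lintegral_mono fun x => ?_) h3
    exact pow_le_pow_left' (hdv n x) 2
  filter_upwards [hev] with n hn
  refine h (v n) (hvc n) ?_ hn fun y => ?_
  · refine HasCompactSupport.mul_right ?_
    exact χ.hasCompactSupport.comp_smul (htpos n).ne'
  · exact (lintegral_mono fun x => pow_le_pow_left' (hχ1 n x) 2).trans (hδ y)

end Cutoff

/-! ### From weak gradients to C¹ functions by mollification. -/

section Mollification

open scoped Convolution

variable {N : ℕ}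

lemma ContDiffBump.lintegral_enorm_normed {E : Type*} [NormedAddCommGroup E] [NormedSpace ℝ E]
    [FiniteDimensional ℝ E] [MeasurableSpace E] [BorelSpace E] (ρ : ContDiffBump (0 : E))
    (μ : Measure E) [μ.IsAddHaarMeasure] : ∫⁻ x, ‖ρ.normed μ x‖ₑ ∂μ = 1 := by
  have h := ofReal_integral_eq_lintegral_ofReal (μ := μ) (f := ρ.normed μ)
    (ρ.continuous_normed.integrable_of_hasCompactSupport ρ.hasCompactSupport_normed)
    (ae_of_all _ fun x => ρ.nonneg_normed x)
  rw [ρ.integral_normed, ENNReal.ofReal_one] at h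
  rw [h]
  exact lintegral_congr fun x => Real.enorm_of_nonneg (ρ.nonneg_normed x)

/-- Mollification does not increase integrals of powers, uniformly over translations. -/
lemma setLIntegral_mollify_le {E : Type*} [NormedAddCommGroup E] [NormedSpace ℝ E]
    [FiniteDimensional ℝ E] [MeasurableSpace E] [BorelSpace E] {F : Type*} [NormedAddCommGroup F]
    [NormedSpace ℝ F] (ρ : ContDiffBump (0 : E)) (μ : Measure E) [μ.IsAddHaarMeasure]
    {g : E → F} (hg : AEStronglyMeasurable g μ) {p : ℝ} (hp : 1 ≤ p) {S : Set E}
    {c : ℝ≥0∞} (hc : ∀ z, ∫⁻ x in S, ‖g (x - z)‖ₑ ^ p ∂μ ≤ c) :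
    ∫⁻ x in S, ‖(ρ.normed μ ⋆[ContinuousLinearMap.lsmul ℝ ℝ, μ] g) x‖ₑ ^ p ∂μ ≤ c := by
  obtain ⟨g', hg', hgg'⟩ := hg
  rw [convolution_congr (ContinuousLinearMap.lsmul ℝ ℝ) (ae_eq_refl _) hgg']
  have hc' : ∀ z, ∫⁻ x in S, ‖g' (x - z)‖ₑ ^ p ∂μ ≤ c := by
    intro z
    refine le_trans (le_of_eq ?_) (hc z)
    refine lintegral_congr_ae (ae_restrict_of_ae ?_)
    filter_upwards [(measurePreserving_sub_right μ z).quasiMeasurePreserving.ae_eq_comp hgg']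
      with x hx
    simp only [Function.comp_apply] at hx
    rw [hx]
  have hρm : Measurable fun z => ‖ρ.normed μ z‖ₑ := ρ.continuous_normed.enorm.measurable
  -- The mollifier is a probability density, so the mollification is dominated by an average of
  -- translates, to which Jensen applies.
  set ν := μ.withDensity fun z => ‖ρ.normed μ z‖ₑ with hν
  have : IsProbabilityMeasure ν := ⟨by
    rw [hν, withDensity_apply _ MeasurableSet.univ, Measure.restrict_univ,
      ρ.lintegral_enorm_normed]⟩
  have hgm : Measurable fun q : E × E => ‖g' (q.1 - q.2)‖ₑ :=
    hg'.enorm.comp (measurable_fst.sub measurable_snd)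
  have hpt : ∀ x, ‖(ρ.normed μ ⋆[ContinuousLinearMap.lsmul ℝ ℝ, μ] g') x‖ₑ ^ p
      ≤ ∫⁻ z, ‖g' (x - z)‖ₑ ^ p ∂ν := by
    intro x
    have hgx : Measurable fun z => ‖g' (x - z)‖ₑ := hgm.comp (measurable_const.prodMk measurable_id)
    refine le_trans ?_ (rpow_lintegral_le_lintegral_rpow hgx.aemeasurable hp)
    refine ENNReal.rpow_le_rpow ?_ (by linarith)
    rw [hν, lintegral_withDensity_eq_lintegral_mul _ hρm hgx]
    refine (enorm_integral_le_lintegral_enorm _).trans (lintegral_mono fun z => ?_)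
    simp [enorm_smul]
  calc _ ≤ ∫⁻ x in S, ∫⁻ z, ‖g' (x - z)‖ₑ ^ p ∂ν ∂μ := lintegral_mono hpt
    _ = ∫⁻ z, ∫⁻ x in S, ‖g' (x - z)‖ₑ ^ p ∂μ ∂ν :=
        lintegral_lintegral_swap (hgm.pow_const p).aemeasurable
    _ ≤ ∫⁻ _, c ∂ν := lintegral_mono hc'
    _ = c := by simp

/-- The gradient of a mollification is the mollification of the weak gradient. -/
lemma fderiv_mollify {u : EuclideanSpace ℝ (Fin N) → ℝ}
    {G : EuclideanSpace ℝ (Fin N) → EuclideanSpace ℝ (Fin N)} (hG : IsWeakGradient u G)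
    (ρ : ContDiffBump (0 : EuclideanSpace ℝ (Fin N))) (x : EuclideanSpace ℝ (Fin N)) :
    fderiv ℝ (ρ.normed volume ⋆[ContinuousLinearMap.lsmul ℝ ℝ, volume] u) x
      = innerSL ℝ ((ρ.normed volume ⋆[ContinuousLinearMap.lsmul ℝ ℝ, volume] G) x) := by
  obtain ⟨hu, hGl, hweak⟩ := hG
  set η := ρ.normed (volume : Measure (EuclideanSpace ℝ (Fin N))) with hη
  have hη1 : ContDiff ℝ 1 η := ρ.contDiff_normed
  have hηc : HasCompactSupport η := ρ.hasCompactSupport_normed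
  set L := (ContinuousLinearMap.lsmul ℝ ℝ : ℝ →L[ℝ] ℝ →L[ℝ] ℝ) with hL
  have hd := hηc.hasFDerivAt_convolution_right L.flip hu hη1 x (μ := volume)
  rw [convolution_flip] at hd
  rw [hd.fderiv]
  -- The test function for the weak gradient. The sign from differentiating t ↦ η(x - t) cancels the
  -- one from integration by parts.
  set φ : EuclideanSpace ℝ (Fin N) → ℝ := fun t => η (x - t) with hφ
  have hφs : ContDiff ℝ ∞ φ := ρ.contDiff_normed.comp (contDiff_const.sub contDiff_id)
  have hφc : HasCompactSupport φ := hηc.comp_homeomorph (Homeomorph.subLeft x)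
  have hint : Integrable (fun t => φ t • G t) volume :=
    hGl.integrable_smul_left_of_hasCompactSupport hφs.continuous hφc
  have hcomp : ∀ i, ∫ t, G t i * φ t = (∫ t, φ t • G t) i := by
    intro i
    have := (EuclideanSpace.proj (𝕜 := ℝ) i).integral_comp_comm hint
    refine Eq.trans ?_ this
    refine integral_congr_ae (ae_of_all _ fun t => ?_)
    simp [mul_comm]
  have hbasis : ∀ i : Fin N,
      (u ⋆[L.flip.precompR (EuclideanSpace ℝ (Fin N)), volume] fderiv ℝ η) x
        (EuclideanSpace.single i 1)
      = (∫ t, φ t • G t) i := by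
    intro i
    rw [convolution_precompR_apply L.flip hu (hηc.fderiv ℝ) (hη1.continuous_fderiv one_ne_zero),
      ← hcomp i, ← neg_eq_iff_eq_neg.2 (hweak φ hφs hφc i), ← integral_neg, convolution_def]
    refine integral_congr_ae (ae_of_all _ fun t => ?_)
    have h1 : HasFDerivAt φ (-(fderiv ℝ η (x - t))) t := by
      have := ((hη1.differentiable one_ne_zero) (x - t)).hasFDerivAt.comp t
        ((hasFDerivAt_id t).const_sub x)
      rwa [ContinuousLinearMap.comp_neg, ContinuousLinearMap.comp_id] at this
    simp only [h1.fderiv, hL, ContinuousLinearMap.flip_apply, ContinuousLinearMap.lsmul_apply,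
      smul_eq_mul, neg_apply]
    ring
  have hconv : (η ⋆[ContinuousLinearMap.lsmul ℝ ℝ, volume] G) x = ∫ t, φ t • G t :=
    convolution_lsmul_swap
  rw [hconv]
  refine ContinuousLinearMap.coe_injective ?_
  refine (EuclideanSpace.basisFun (Fin N) ℝ).toBasis.ext fun i => ?_
  simp only [OrthonormalBasis.coe_toBasis, EuclideanSpace.basisFun_apply,
    ContinuousLinearMap.coe_coe]
  rw [hbasis i, innerSL_apply_apply, EuclideanSpace.inner_single_right]
  simp

/-- A bound valid for compactly supported `C¹` functions extends to functions in the critical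
Lebesgue space with a square integrable weak gradient. -/
lemma lintegral_comp_le_of_isWeakGradient (hN : 3 ≤ N) {H : ℝ → ℝ≥0∞} (hH : Continuous H) {R : ℝ}
    {K δ c : ℝ≥0∞}
    (h : ∀ w : EuclideanSpace ℝ (Fin N) → ℝ, ContDiff ℝ 1 w → HasCompactSupport w →
      ∫⁻ x, ‖fderiv ℝ w x‖ₑ ^ 2 ≤ K → (∀ y, ∫⁻ x in Metric.ball y R, ‖w x‖ₑ ^ 2 ≤ δ) →
      ∫⁻ x, H (w x) ≤ c)
    {u : EuclideanSpace ℝ (Fin N) → ℝ}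
    {G : EuclideanSpace ℝ (Fin N) → EuclideanSpace ℝ (Fin N)} (hG : IsWeakGradient u G)
    (hcrit : ∫⁻ x, ‖u x‖ₑ ^ critExp N ≠ ⊤) (hK : ∫⁻ x, ‖G x‖ₑ ^ 2 < K)
    (hδ : ∀ y, ∫⁻ x in Metric.ball y R, ‖u x‖ₑ ^ 2 ≤ δ) :
    ∫⁻ x, H (u x) ≤ c := by
  have h2 := two_lt_critExp hN
  -- The ratio of outer to inner radius is fixed at 2; a bounded ratio is what yields almost
  -- everywhere convergence for a merely locally integrable function.
  let ρ : ℕ → ContDiffBump (0 : EuclideanSpace ℝ (Fin N)) := fun n =>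
    ⟨((n : ℝ) + 1)⁻¹, 2 * ((n : ℝ) + 1)⁻¹, by positivity, by
      have : (0 : ℝ) < ((n : ℝ) + 1)⁻¹ := by positivity
      linarith⟩
  have hρ0 : Tendsto (fun n => (ρ n).rOut) atTop (𝓝 0) := by
    have := (tendsto_one_div_add_atTop_nhds_zero_nat (𝕜 := ℝ)).const_mul 2
    simpa only [one_div, mul_zero] using this
  have hlim := ContDiffBump.ae_convolution_tendsto_right_of_locallyIntegrable (μ := volume) (K := 2)
    hρ0 (Eventually.of_forall fun n => le_rfl) hG.1
  have hC : ∀ n, ContDiff ℝ 1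
      ((ρ n).normed volume ⋆[ContinuousLinearMap.lsmul ℝ ℝ, volume] u) := fun n =>
    (ρ n).hasCompactSupport_normed.contDiff_convolution_left (n := 1) _ (ρ n).contDiff_normed hG.1
  have hum := hG.1.aestronglyMeasurable
  have hGm := hG.2.1.aestronglyMeasurable
  refine lintegral_comp_le_of_ae_tendsto hH (fun n => (hC n).continuous.measurable) hlim
    (Eventually.of_forall fun n => ?_)
  refine lintegral_comp_le_of_contDiff hN hH h (hC n) (ne_top_of_le_ne_top hcrit ?_)
    (lt_of_le_of_lt ?_ hK) fun y => ?_
  · have := setLIntegral_mollify_le (ρ n) volume hum (p := critExp N) (by linarith) (S := univ)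
      (c := ∫⁻ x, ‖u x‖ₑ ^ critExp N) fun z => by
        rw [Measure.restrict_univ]
        exact (lintegral_sub_right_eq_self (fun x => ‖u x‖ₑ ^ critExp N) z).le
    rwa [Measure.restrict_univ] at this
  · have := setLIntegral_mollify_le (ρ n) volume hGm (p := 2) (by norm_num) (S := univ)
      (c := ∫⁻ x, ‖G x‖ₑ ^ 2) fun z => by
        rw [Measure.restrict_univ]
        simp only [ENNReal.rpow_two]
        exact (lintegral_sub_right_eq_self (fun x => ‖G x‖ₑ ^ 2) z).le
    rw [Measure.restrict_univ] at this
    simp only [ENNReal.rpow_two] at this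
    refine le_trans (lintegral_mono fun x => ?_) this
    rw [fderiv_mollify hG (ρ n) x, ← ofReal_norm, innerSL_apply_norm, ofReal_norm]
  -- The bound on local masses holds for every centre, so it is inherited by translates and hence by
  -- their average.
  · have := setLIntegral_mollify_le (ρ n) volume hum (p := 2) (by norm_num)
      (S := Metric.ball y R) (c := δ) fun z => by
        simp only [ENNReal.rpow_two]
        refine le_trans (le_of_eq ?_) (hδ (y - z))
        rw [← lintegral_indicator Metric.isOpen_ball.measurableSet,
          ← lintegral_indicator Metric.isOpen_ball.measurableSet,
          ← lintegral_sub_right_eq_self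
            ((Metric.ball (y - z) R).indicator fun x => ‖u x‖ₑ ^ 2) z]
        refine lintegral_congr fun x => ?_
        by_cases hx : x ∈ Metric.ball y R
        · rw [indicator_of_mem hx, indicator_of_mem]
          simpa [Metric.mem_ball, dist_eq_norm] using hx
        · rw [indicator_of_notMem hx, indicator_of_notMem]
          simpa [Metric.mem_ball, dist_eq_norm] using hx
    simpa only [ENNReal.rpow_two] using this

end Mollification

/-! ### Splitting the nonlinearity into a small critical part and a truncated part. -/

section Nonlinearity

variable {N : ℕ} {f : ℝ → ℝ}

lemma oddExt_mul_self (f : ℝ → ℝ) (s : ℝ) : oddExt f s * s = f |s| * |s| := by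
  unfold oddExt
  split_ifs with h
  · rw [abs_of_nonneg h]
  · rw [abs_of_neg (not_le.1 h)]
    ring

/-- Nothing is known of f on the negative axis, so it is replaced by the continuous function s ↦
f(max(s, 0)) in both branches. -/
lemma measurable_oddExt (hf : ContinuousOn f (Ici 0)) : Measurable (oddExt f) := by
  have h : Measurable fun s : ℝ => f (max s 0) := by
    have : Continuous fun s : ℝ => f (max s 0) :=
      hf.comp_continuous (by fun_prop) fun s => mem_Ici.2 (le_max_right s 0)
    exact this.measurable
  have heq : oddExt f = fun s => if 0 ≤ s then f (max s 0) else -f (max (-s) 0) := by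
    ext s
    unfold oddExt
    split_ifs with hs
    · rw [max_eq_left hs]
    · rw [max_eq_left (by linarith)]
  rw [heq]
  exact Measurable.ite measurableSet_Ici h (h.comp measurable_neg).neg

/-- The growth condition, in terms of `f(s)s`, with the two exponents on the respective sides of
the critical one. -/
lemma DoublePowerGrowth.abs_oddExt_mul_le (hN : 3 ≤ N) (hf : DoublePowerGrowth N f) :
    ∃ A p q : ℝ, 0 < A ∧ p < critExp N ∧ critExp N < q ∧
      (∀ s : ℝ, 1 ≤ |s| → |oddExt f s * s| ≤ A * |s| ^ p) ∧
      (∀ s : ℝ, |s| ≤ 1 → |oddExt f s * s| ≤ A * |s| ^ q) := by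
  obtain ⟨-, A, p, q, hA, hp2, hp, hq, hlarge, hsmall⟩ := hf
  have h2 := two_lt_critExp hN
  refine ⟨A, p, q, hA, hp, hq, fun s hs => ?_, fun s hs => ?_⟩ <;>
    rw [oddExt_mul_self, abs_mul, abs_abs]
  · calc |f (|s|)| * |s| ≤ A * |s| ^ (p - 1) * |s| := by gcongr; exact (hlarge _ hs).2.1
      _ = A * |s| ^ p := by
        rw [mul_assoc, ← Real.rpow_add_one (by linarith), sub_add_cancel]
  · rcases eq_or_lt_of_le (abs_nonneg s) with h0 | h0
    · rw [← h0, mul_zero]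
      positivity
    · calc |f (|s|)| * |s| ≤ A * |s| ^ (q - 1) * |s| := by
            gcongr; exact (hsmall _ h0.le hs).2.1
        _ = A * |s| ^ q := by
          rw [mul_assoc, ← Real.rpow_add_one h0.ne', sub_add_cancel]

/-- Since p < 2* < q, each power is dominated by the critical one on its own side of 1. This gives
integrability, and the bound for intermediate values of s. -/
lemma DoublePowerGrowth.exists_abs_le_critical (hN : 3 ≤ N) (hf : DoublePowerGrowth N f) :
    ∃ A : ℝ, 0 < A ∧ ∀ s, |oddExt f s * s| ≤ A * |s| ^ critExp N := by
  obtain ⟨A, p, q, hA, hp, hq, hlarge, hsmall⟩ := hf.abs_oddExt_mul_le hN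
  have h0 := critExp_pos hN
  refine ⟨A, hA, fun s => ?_⟩
  rcases le_total |s| 1 with h | h
  · refine (hsmall s h).trans ?_
    gcongr ?_ * ?_
    rcases eq_or_lt_of_le (abs_nonneg s) with hs | hs
    · rw [← hs, Real.zero_rpow (by linarith), Real.zero_rpow h0.ne']
    · exact Real.rpow_le_rpow_of_exponent_ge hs h hq.le
  · refine (hlarge s h).trans ?_
    gcongr ?_ * ?_
    exact Real.rpow_le_rpow_of_exponent_le h hp.le

/-- The nonlinearity is subcritical at infinity and supercritical at the origin: up to a small
multiple of the critical power it is controlled away from both. -/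
lemma DoublePowerGrowth.exists_abs_le_add (hN : 3 ≤ N) (hf : DoublePowerGrowth N f) {r : ℝ}
    (hr : 0 ≤ r) {η : ℝ} (hη : 0 < η) :
    ∃ C : ℝ, 0 ≤ C ∧
      ∀ s, |oddExt f s * s| ≤ η * |s| ^ critExp N + C * |cubicProfile s| ^ r := by
  obtain ⟨A', hA', hcrit⟩ := hf.exists_abs_le_critical hN
  obtain ⟨A, p, q, hA, hp, hq, hlarge, hsmall⟩ := hf.abs_oddExt_mul_le hN
  have h0 := critExp_pos hN
  have hηA : 0 < η / A := by positivity
  -- Two thresholds: near 0 the factor |s|^{q-2*}, and near infinity the factor |s|^{p-2*}, fall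
  -- below η/A.
  have h1 : ∀ᶠ x : ℝ in 𝓝 0, x ^ (q - critExp N) < η / A := by
    have hc : ContinuousAt (fun x : ℝ => x ^ (q - critExp N)) 0 :=
      Real.continuousAt_rpow_const _ _ (Or.inr (by linarith))
    refine hc.eventually_lt continuousAt_const ?_
    rwa [Real.zero_rpow (by linarith)]
  obtain ⟨ε, hε, hε'⟩ := Metric.eventually_nhds_iff.1 h1
  have h2 : ∀ᶠ x : ℝ in atTop, x ^ (-(critExp N - p)) < η / A :=
    (tendsto_rpow_neg_atTop (by linarith)).eventually_lt_const hηA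
  obtain ⟨b, hb⟩ := eventually_atTop.1 h2
  set a := min ε 1 with ha
  have ha0 : 0 < a := by positivity
  set B := max b 1 with hB
  set m := (a ^ 3 / (1 + a ^ 2)) ^ r with hm
  have hm0 : 0 < m := by positivity
  -- Only a ≤ |s| ≤ B needs the second term: there the left side is at most A'B^{2*}, while |ψ(s)|^r
  -- is at least m.
  refine ⟨A' * B ^ critExp N / m, by positivity, fun s => ?_⟩
  have hn : 0 ≤ η * |s| ^ critExp N := by positivity
  have hn2 : 0 ≤ A' * B ^ critExp N / m * |cubicProfile s| ^ r := by positivity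
  have hs0 := abs_nonneg s
  by_cases hsa : |s| < a
  · refine le_add_of_le_of_nonneg ?_ hn2
    refine (hsmall s (hsa.le.trans (min_le_right _ _))).trans ?_
    rcases eq_or_lt_of_le hs0 with hs | hs
    · rw [← hs, Real.zero_rpow (by linarith), Real.zero_rpow h0.ne']
      simp
    · have := hε' (y := |s|) (by
        rw [Real.dist_eq, sub_zero, abs_abs]
        exact hsa.trans_le (min_le_left _ _))
      rw [lt_div_iff₀ hA] at this
      calc A * |s| ^ q = |s| ^ (q - critExp N) * A * |s| ^ critExp N := by
            rw [mul_right_comm, ← Real.rpow_add hs, sub_add_cancel, mul_comm]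
        _ ≤ η * |s| ^ critExp N := by gcongr
  push Not at hsa
  by_cases hsB : |s| ≤ B
  · refine le_add_of_nonneg_of_le hn ?_
    calc |oddExt f s * s| ≤ A' * |s| ^ critExp N := hcrit s
      _ ≤ A' * B ^ critExp N := by gcongr
      _ = A' * B ^ critExp N / m * m := by field_simp
      _ ≤ _ := by
        gcongr
        exact Real.rpow_le_rpow (by positivity) (abs_cubicProfile_mono ha0.le hsa) hr
  · push Not at hsB
    refine le_add_of_le_of_nonneg ?_ hn2
    have hs1 : 1 ≤ |s| := (le_max_right b 1).trans hsB.le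
    refine (hlarge s hs1).trans ?_
    have := hb |s| ((le_max_left b 1).trans hsB.le)
    rw [lt_div_iff₀ hA] at this
    calc A * |s| ^ p = |s| ^ (-(critExp N - p)) * A * |s| ^ critExp N := by
          rw [mul_right_comm, ← Real.rpow_add (by linarith), mul_comm]
          congr 2
          ring
      _ ≤ η * |s| ^ critExp N := by gcongr

end Nonlinearity

/-! ### Bounds for elements of D^{1,2}, and the theorem. -/

section Main

variable {N : ℕ}

lemma MemD12.weakGrad_spec {u : EuclideanSpace ℝ (Fin N) → ℝ} (hu : MemD12 u) :
    IsWeakGradient u (weakGrad u) ∧ MemLp (weakGrad u) 2 volume := by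
  unfold weakGrad
  rw [dif_pos hu.2]
  exact hu.2.choose_spec

lemma MemD12.lintegral_critical_ne_top (hN : 3 ≤ N) {u : EuclideanSpace ℝ (Fin N) → ℝ}
    (hu : MemD12 u) : ∫⁻ x, ‖u x‖ₑ ^ critExp N ≠ ⊤ := by
  have h0 := critExp_pos hN
  have := lintegral_rpow_enorm_lt_top_of_eLpNorm_lt_top (by simpa using h0) (by simp) hu.1.2
  rw [ENNReal.toReal_ofReal h0.le] at this
  exact this.ne

lemma MemD12.lintegral_weakGrad_sq_le {u : EuclideanSpace ℝ (Fin N) → ℝ} (hu : MemD12 u) {C : ℝ}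
    (hC : d12Norm u ≤ C) : ∫⁻ x, ‖weakGrad u x‖ₑ ^ 2 ≤ ENNReal.ofReal (C ^ 2) := by
  -- Integrability ensures that the Bochner integral in `d12Norm` is the true one and not the
  -- default value 0.
  have hint : Integrable (fun x => ‖weakGrad u x‖ ^ 2) volume :=
    hu.weakGrad_spec.2.integrable_norm_pow (by norm_num)
  have h := ofReal_integral_eq_lintegral_ofReal hint (ae_of_all _ fun x => by positivity)
  simp_rw [ENNReal.ofReal_pow (norm_nonneg _), ofReal_norm] at h
  rw [← h]
  exact ENNReal.ofReal_le_ofReal (Real.sqrt_le_iff.1 hC).2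

end Main

end

theorem lemma3p5 (N : ℕ) (hN : 3 ≤ N) (f : ℝ → ℝ) (hf : DoublePowerGrowth N f)
    (u : ℕ → EuclideanSpace ℝ (Fin N) → ℝ) (hu : ∀ k, MemD12 (u k))
    (hbdd : ∃ C : ℝ, ∀ k, d12Norm (u k) ≤ C)
    (hvanish : ∃ R : ℝ, 0 < R ∧
      Tendsto (fun k => ⨆ y : EuclideanSpace ℝ (Fin N),
        ∫⁻ x in Metric.ball y R, ‖u k x‖ₑ ^ 2) atTop (𝓝 0)) :
    (∀ k, Integrable (fun x => oddExt f (u k x) * u k x) volume) ∧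
      Tendsto (fun k => ∫ x, oddExt f (u k x) * u k x) atTop (𝓝 0) := by
  have h0 := critExp_pos hN
  have hN0 : (0 : ℝ) < N := by linarith [critExp_sub_pos hN]
  obtain ⟨D, hD⟩ := hbdd
  obtain ⟨R, hR, hlim⟩ := hvanish
  have hcrit : ∀ k, ∫⁻ x, ‖u k x‖ₑ ^ critExp N ≠ ⊤ := fun k =>
    (hu k).lintegral_critical_ne_top hN
  have hum : ∀ k, AEMeasurable (u k) volume := fun k => (hu k).1.1.aemeasurable
  refine ⟨fun k => ⟨?_, ?_⟩, ?_⟩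
  · exact (((measurable_oddExt hf.1.continuousOn).comp_aemeasurable (hum k)).mul
      (hum k)).aestronglyMeasurable
  · obtain ⟨A, hA, hfA⟩ := hf.exists_abs_le_critical hN
    calc ∫⁻ x, ‖oddExt f (u k x) * u k x‖ₑ
        ≤ ∫⁻ x, ENNReal.ofReal A * ‖u k x‖ₑ ^ critExp N := by
          refine lintegral_mono fun x => ?_
          rw [← ofReal_norm, ← ofReal_norm, ENNReal.ofReal_rpow_of_nonneg (norm_nonneg _) h0.le,
            ← ENNReal.ofReal_mul hA.le]
          exact ENNReal.ofReal_le_ofReal (hfA (u k x))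
      _ = ENNReal.ofReal A * ∫⁻ x, ‖u k x‖ₑ ^ critExp N :=
          lintegral_const_mul' _ _ ENNReal.ofReal_ne_top
      _ < ⊤ := ENNReal.mul_lt_top ENNReal.ofReal_lt_top (hcrit k).lt_top
  -- The added 1 makes the gradient bound strict, as the approximation lemma requires.
  · set K : ℝ≥0∞ := ENNReal.ofReal (D ^ 2) + 1 with hK
    have hKtop : K ≠ ⊤ := by finiteness
    have hGK : ∀ k, ∫⁻ x, ‖weakGrad (u k) x‖ₑ ^ 2 < K := fun k =>
      ((hu k).lintegral_weakGrad_sq_le (hD k)).trans_lt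
        (ENNReal.lt_add_right ENNReal.ofReal_ne_top one_ne_zero)
    obtain ⟨S, hS, hsob⟩ := exists_sobolev_const hN
    set Λ : ℝ≥0∞ := (S * K) ^ (critExp N / 2) with hΛ
    have hΛtop : Λ ≠ ⊤ :=
      ENNReal.rpow_ne_top_of_nonneg (by positivity) (ENNReal.mul_ne_top hS hKtop)
    have hsobu : ∀ k, ∫⁻ x, ‖u k x‖ₑ ^ critExp N ≤ Λ := by
      intro k
      -- With δ = ⊤ the condition on local masses is void, and the result is the Sobolev inequality
      -- on D^{1,2}.
      refine lintegral_comp_le_of_isWeakGradient hN (H := fun s => ‖s‖ₑ ^ critExp N) (R := R)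
        (δ := ⊤) (ENNReal.continuous_rpow_const.comp continuous_enorm) (fun w hw hcw hwK _ => ?_)
        (hu k).weakGrad_spec.1 (hcrit k) (hGK k) fun _ => le_top
      have := ENNReal.rpow_le_rpow ((hsob w hw hcw).trans (mul_le_mul_right hwK S))
        (z := critExp N / 2) (by positivity)
      rwa [← ENNReal.rpow_mul, show 2 / critExp N * (critExp N / 2) = 1 by field_simp,
        ENNReal.rpow_one] at this
    obtain ⟨C, hC, hvan⟩ := exists_vanishing_const hN hR hKtop
    set δ : ℕ → ℝ≥0∞ := fun k => ⨆ y : EuclideanSpace ℝ (Fin N),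
        ∫⁻ x in Metric.ball y R, ‖u k x‖ₑ ^ 2 with hδ
    set r : ℝ := 2 + 4 / (N : ℝ) with hr
    have hr0 : 0 ≤ r := by positivity
    have hvanu : ∀ k, δ k ≠ ⊤ →
        ∫⁻ x, ‖cubicProfile (u k x)‖ₑ ^ r ≤ C * δ k ^ (2 / (N : ℝ)) := fun k hk =>
      lintegral_comp_le_of_isWeakGradient hN (H := fun s => ‖cubicProfile s‖ₑ ^ r)
        (ENNReal.continuous_rpow_const.comp contDiff_cubicProfile.continuous.enorm)
        (fun w hw hcw hwK hwδ => hvan w hw hcw hwK (δ k) hk hwδ)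
        (hu k).weakGrad_spec.1 (hcrit k) (hGK k)
        fun y => le_iSup (fun y => ∫⁻ x in Metric.ball y R, ‖u k x‖ₑ ^ 2) y
    have hfin : ∀ᶠ k in atTop, δ k ≠ ⊤ :=
      (hlim.eventually_lt_const (zero_lt_one)).mono fun k hk => (hk.trans ENNReal.one_lt_top).ne
    have hmain : Tendsto (fun k => ∫⁻ x, ‖oddExt f (u k x) * u k x‖ₑ) atTop (𝓝 0) := by
      rw [ENNReal.tendsto_nhds_zero]
      intro ε hε
      -- η is fixed first, uniformly in k; the constant c then depends on η only, and k → ∞ makes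
      -- the remaining term small.
      obtain ⟨η, hη, hηε⟩ : ∃ η : ℝ, 0 < η ∧ ENNReal.ofReal η * Λ ≤ ε / 2 := by
        have : Tendsto (fun η : ℝ => ENNReal.ofReal η * Λ) (𝓝[>] 0) (𝓝 0) := by
          have h := ENNReal.Tendsto.mul_const (b := Λ)
            (ENNReal.tendsto_ofReal (tendsto_id (x := 𝓝 (0 : ℝ)))) (Or.inr hΛtop)
          simp only [id, ENNReal.ofReal_zero, zero_mul] at h
          exact h.mono_left nhdsWithin_le_nhds
        obtain ⟨η, h1, h2⟩ := ((this.eventually_le_const (ENNReal.half_pos hε.ne')).and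
          self_mem_nhdsWithin).exists
        exact ⟨η, h2, h1⟩
      obtain ⟨c, hc, hfc⟩ := hf.exists_abs_le_add hN hr0 hη
      have hsmall : Tendsto (fun k => ENNReal.ofReal c * (C * δ k ^ (2 / (N : ℝ)))) atTop
          (𝓝 0) := by
        have h := ENNReal.Tendsto.const_mul (a := ENNReal.ofReal c) (ENNReal.Tendsto.const_mul
          (a := C) (hlim.ennrpow_const (2 / (N : ℝ))) (Or.inr hC)) (Or.inr ENNReal.ofReal_ne_top)
        rwa [ENNReal.zero_rpow_of_pos (by positivity), mul_zero, mul_zero] at h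
      filter_upwards [hfin, hsmall.eventually_le_const (ENNReal.half_pos hε.ne')] with k hk hk2
      calc ∫⁻ x, ‖oddExt f (u k x) * u k x‖ₑ
          ≤ ∫⁻ x, (ENNReal.ofReal η * ‖u k x‖ₑ ^ critExp N
              + ENNReal.ofReal c * ‖cubicProfile (u k x)‖ₑ ^ r) := by
            refine lintegral_mono fun x => ?_
            rw [← ofReal_norm, ← ofReal_norm, ← ofReal_norm,
              ENNReal.ofReal_rpow_of_nonneg (norm_nonneg _) h0.le,
              ENNReal.ofReal_rpow_of_nonneg (norm_nonneg _) hr0,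
              ← ENNReal.ofReal_mul hη.le, ← ENNReal.ofReal_mul hc,
              ← ENNReal.ofReal_add (by positivity) (by positivity)]
            exact ENNReal.ofReal_le_ofReal (hfc (u k x))
        _ = ENNReal.ofReal η * (∫⁻ x, ‖u k x‖ₑ ^ critExp N)
              + ENNReal.ofReal c * ∫⁻ x, ‖cubicProfile (u k x)‖ₑ ^ r := by
            rw [lintegral_add_left' (((hum k).enorm.pow_const _).const_mul _),
              lintegral_const_mul' _ _ ENNReal.ofReal_ne_top,
              lintegral_const_mul' _ _ ENNReal.ofReal_ne_top]
        _ ≤ ENNReal.ofReal η * Λ + ENNReal.ofReal c * (C * δ k ^ (2 / (N : ℝ))) := by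
            gcongr
            · exact hsobu k
            · exact hvanu k hk
        _ ≤ ε / 2 + ε / 2 := add_le_add hηε hk2
        _ = ε := ENNReal.add_halves ε
    rw [tendsto_zero_iff_enorm_tendsto_zero]
    exact tendsto_of_tendsto_of_tendsto_of_le_of_le tendsto_const_nhds hmain
      (fun _ => zero_le) fun k => enorm_integral_le_lintegral_enorm _
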